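/- Let $\kappa\ge 1$ be an integer, let $\chi$ be a probability distribution on $\{0,1,2,\dots\}$ with $\chi(0)<1$ and generating function $G(x)=\sum_{m\ge0}\chi(m)x^m$, and let $p_{-1},p_0,p_1\in[0,1]$ with $p_{-1}+p_0+p_1=1$. Let $T$ be the rooted Galton–Watson tree with offspring distribution $\chi$, whose edges carry independent weights (independent of the tree) that equal $s$ with probability $p_s$, $s\in\{-1,0,1\}$. On a realization of $T$, fully known to both players, two players alternately move a token, which starts at the root, from its current vertex to a child of that vertex; whoever moves adds the weight of the traversed edge to her capital. A player wins as soon as her capital reaches $\kappa$ or her opponent's capital reaches $0$; if neither has happened and the token is at a leaf, the player who has to move loses. A player wins the game if she has a strategy that wins (in finite time) against every strategy of the opponent; the game is a draw if neither player has one. For $i,j\in\{1,\dots,\kappa-1\}$ let $w_{i,j}$, $\ell_{i,j}$, $d_{i,j}$ be the probabilities that the player who moves first wins, loses, draws, when she starts with capital $i$ and her opponent with capital $j$. Let $W=(w_{i,j})$ and $L=(\ell_{i,j})$, of size $(\kappa-1)\times(\kappa-1)$. Let $\mathcal S$ be the set of $(\kappa-1)\times(\kappa-1)$ matrices with entries in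 $[0,1]$, $\mathbf 1$ the all-ones column vector, $\mathbf e_1$ the first standard basis vector, $J=\mathbf 1\mathbf 1^{T}$, and $P$ the matrix with $P_{i,i-1}=p_{-1}$, $P_{i,i}=p_0$, $P_{i,i+1}=p_1$ and all other entries $0$. Write $A\preceq B$ for the entrywise order, let $f$ apply $G$ to every entry of a matrix, and put $$h(X)=f\left[p_{-1}\mathbf e_1\mathbf 1^{T}+P\left\{J-f\left(p_{-1}\mathbf 1\mathbf e_1^{T}+(J-X)P^{T}\right)\right\}\right],\qquad g(X)=f\left[p_{-1}\mathbf e_1\mathbf 1^{T}+P\left(J-X^{T}\right)\right].$$ Then $h$ and $g$ map $\mathcal S$ to itself, $h=g\circ g$ on $\mathcal S$, and: 1. $L$ and $J-W$ belong to $\mathcal S$ and are fixed points of $h$. 2. Every fixed point $\hat X\in\mathcal S$ of $h$ satisfies $L\preceq\hat X\preceq J-W$. 3. $d_{i,j}=0$ for all $i,j\in\{1,\dots,\kappa-1\}$ if and only if $h$ has a unique fixed point in $\mathcal S$. 4. If $h$ has a unique fixed point in $\mathcal S$, then $g$ has a unique fixed point in $\mathcal S$, and this fixed point of $g$ equals both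 $L$ and $J-W$. -/

import Mathlib

open MeasureTheory

noncomputable section

namespace TreeGame

instance : MeasurableSpace SignType := ⊤

instance : DiscreteMeasurableSpace SignType := ⟨fun _ => trivial⟩

/-- A locally finite rooted tree with edge weights in `{-1, 0, 1}`, in Ulam–Harris coding. The root
is `[]`, the children of the vertex `u` are `u ++ [0], …, u ++ [m - 1]` where `m = (t u).1`, and
`(t u).2` is the weight of the edge from the parent of `u` to `u` (without meaning at the root).
Addresses that cannot be reached from the root play no role. -/
abbrev WeightedTree := List ℕ → ℕ × SignType

namespace WeightedTree

/-- The number of children of the vertex `u`. -/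
def numChildren (t : WeightedTree) (u : List ℕ) : ℕ := (t u).1

/-- The weight of the edge from `u` to its child `u ++ [k]`. -/
def weight (t : WeightedTree) (u : List ℕ) (k : ℕ) : ℤ := ((t (u ++ [k])).2 : ℤ)

end WeightedTree

/-! ### The game on a deterministic weighted tree -/

/-- The situation in the game after some number of moves. -/
structure State where
  /-- the vertex at which the token is -/
  token : List ℕ
  /-- the capital of the first player -/
  cap₁ : ℤ
  /-- the capital of the second player -/
  cap₂ : ℤ
  /-- whether it is the turn of the first player -/
  firstToMove : Bool

/-- The verdict on a situation: one of the players has won, or the game goes on. -/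
inductive Verdict
  | firstWon
  | secondWon
  | undecided

/-- Capitals are examined before the token's vertex is tested for being a leaf. -/
def verdict (κ : ℕ) (t : WeightedTree) (s : State) : Verdict :=
  if (κ : ℤ) ≤ s.cap₁ ∨ s.cap₂ ≤ 0 then Verdict.firstWon
  else if (κ : ℤ) ≤ s.cap₂ ∨ s.cap₁ ≤ 0 then Verdict.secondWon
  else if t.numChildren s.token = 0 then
    (if s.firstToMove then Verdict.secondWon else Verdict.firstWon)
  else Verdict.undecided

/-- The player whose turn it is moves the token to the `k`-th child and collects the weight. -/
def move (t : WeightedTree) (s : State) (k : ℕ) : State where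
  token := s.token ++ [k]
  cap₁ := if s.firstToMove then s.cap₁ + t.weight s.token k else s.cap₁
  cap₂ := if s.firstToMove then s.cap₂ else s.cap₂ + t.weight s.token k
  firstToMove := !s.firstToMove

/-- A strategy chooses a child of every vertex that has one. As the game is played on a tree, from
a fixed initial situation, the current vertex determines the whole history of the play. -/
def Strategy (t : WeightedTree) : Type :=
  {σ : List ℕ → ℕ // ∀ u, t.numChildren u ≠ 0 → σ u < t.numChildren u}

/-- One round of the game, if the players follow the strategies `σ₁` and `σ₂`. A decided game does
not change any more. -/
def gameRound (κ : ℕ) (t : WeightedTree) (σ₁ σ₂ : Strategy t) (s : State) : State :=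
  match verdict κ t s with
  | Verdict.undecided => move t s (if s.firstToMove then σ₁.1 s.token else σ₂.1 s.token)
  | _ => s

/-- The situation after `n` rounds of the game that starts at the vertex `v` with capitals `i` and
`j`, the first player making the first move. -/
def play (κ : ℕ) (t : WeightedTree) (v : List ℕ) (i j : ℕ) (σ₁ σ₂ : Strategy t) (n : ℕ) : State :=
  (gameRound κ t σ₁ σ₂)^[n] ⟨v, i, j, true⟩

/-- The first player wins: she has a strategy that makes her win against every strategy of her
opponent. -/
def FirstWins (κ : ℕ) (t : WeightedTree) (v : List ℕ) (i j : ℕ) : Prop :=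
  ∃ σ₁ : Strategy t, ∀ σ₂ : Strategy t, ∃ n, verdict κ t (play κ t v i j σ₁ σ₂ n) = Verdict.firstWon

/-- The first player loses: the second player has a strategy that makes her win against every
strategy of the first player. -/
def FirstLoses (κ : ℕ) (t : WeightedTree) (v : List ℕ) (i j : ℕ) : Prop :=
  ∃ σ₂ : Strategy t, ∀ σ₁ : Strategy t, ∃ n,
    verdict κ t (play κ t v i j σ₁ σ₂ n) = Verdict.secondWon

/-- The game is a draw: neither player is able to force a win. -/
def IsDraw (κ : ℕ) (t : WeightedTree) (v : List ℕ) (i j : ℕ) : Prop :=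
  ¬ FirstWins κ t v i j ∧ ¬ FirstLoses κ t v i j

/-! ### The edge-weighted Galton–Watson tree -/

/-- The law of the Galton–Watson tree with offspring distribution `χ` and independent edge weights
of law `p`: numbers of children and edge weights are all independent. -/
def gwMeasure (χ : PMF ℕ) (p : PMF SignType) : Measure WeightedTree :=
  Measure.infinitePi fun _ : List ℕ => χ.toMeasure.prod p.toMeasure

/-- `W i j` is the probability that the first player wins from the root, with initial capitals
`i + 1` and `j + 1` (the indices in `Fin (κ - 1)` start from `0`). -/
def winMatrix (κ : ℕ) (χ : PMF ℕ) (p : PMF SignType) : Matrix (Fin (κ - 1)) (Fin (κ - 1)) ℝ :=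
  Matrix.of fun i j => (gwMeasure χ p).real {t | FirstWins κ t [] (i + 1) (j + 1)}

/-- `L i j` is the probability that the first player loses. -/
def lossMatrix (κ : ℕ) (χ : PMF ℕ) (p : PMF SignType) : Matrix (Fin (κ - 1)) (Fin (κ - 1)) ℝ :=
  Matrix.of fun i j => (gwMeasure χ p).real {t | FirstLoses κ t [] (i + 1) (j + 1)}

/-- The probabilities of a draw. -/
def drawMatrix (κ : ℕ) (χ : PMF ℕ) (p : PMF SignType) : Matrix (Fin (κ - 1)) (Fin (κ - 1)) ℝ :=
  Matrix.of fun i j => (gwMeasure χ p).real {t | IsDraw κ t [] (i + 1) (j + 1)}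

/-! ### The maps `h` and `g` -/

/-- The probability generating function of `χ`. -/
def pgf (χ : PMF ℕ) (x : ℝ) : ℝ := ∑' m : ℕ, x ^ m * (χ m).toReal

/-- The probabilities `p₋₁`, `p₀`, `p₁` of the edge weights as real numbers. -/
def prob (p : PMF SignType) (s : SignType) : ℝ := (p s).toReal

/-- The square matrices with entries in `[0, 1]`. -/
def unitMatrices (n : ℕ) : Set (Matrix (Fin n) (Fin n) ℝ) :=
  {X | ∀ i j, X i j ∈ Set.Icc (0 : ℝ) 1}

/-- The all-ones matrix `J`. -/
def onesMatrix (n : ℕ) : Matrix (Fin n) (Fin n) ℝ := Matrix.of fun _ _ => 1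

/-- The first standard basis vector `e₁`. -/
def firstVec (n : ℕ) : Fin n → ℝ := fun i => if (i : ℕ) = 0 then 1 else 0

/-- The tridiagonal matrix `P`. -/
def stepMatrix (n : ℕ) (p : PMF SignType) : Matrix (Fin n) (Fin n) ℝ :=
  Matrix.of fun i j =>
    if (j : ℕ) + 1 = i then prob p (-1)
    else if j = i then prob p 0
    else if (j : ℕ) = i + 1 then prob p 1
    else 0

/-- The generating function applied to every entry. -/
def fMap {n : ℕ} (χ : PMF ℕ) (A : Matrix (Fin n) (Fin n) ℝ) : Matrix (Fin n) (Fin n) ℝ :=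
  A.map (pgf χ)

open scoped Matrix in
/-- `h(X) = f[p₋₁ e₁ 1ᵀ + P {J - f(p₋₁ 1 e₁ᵀ + (J - X) Pᵀ)}]`. -/
def hMap {n : ℕ} (χ : PMF ℕ) (p : PMF SignType) (X : Matrix (Fin n) (Fin n) ℝ) :
    Matrix (Fin n) (Fin n) ℝ :=
  fMap χ (prob p (-1) • Matrix.vecMulVec (firstVec n) 1 +
    stepMatrix n p * (onesMatrix n -
      fMap χ (prob p (-1) • Matrix.vecMulVec 1 (firstVec n) +
        (onesMatrix n - X) * (stepMatrix n p)ᵀ)))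

open scoped Matrix in
/-- `g(X) = f[p₋₁ e₁ 1ᵀ + P (J - Xᵀ)]`. -/
def gMap {n : ℕ} (χ : PMF ℕ) (p : PMF SignType) (X : Matrix (Fin n) (Fin n) ℝ) :
    Matrix (Fin n) (Fin n) ℝ :=
  fMap χ (prob p (-1) • Matrix.vecMulVec (firstVec n) 1 + stepMatrix n p * (onesMatrix n - Xᵀ))

end TreeGame

end

open TreeGame

noncomputable section

namespace TreeGame

/-! Every vertex has finitely many children, so backward induction shows that a player has a winning
strategy exactly when she can force a win within a bounded number of moves
(`exists_winning_strategy_iff`). Hence `W` and `L` are the increasing limits of the probabilities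
`W_n` and `L_n` of a win or a loss within `n` moves.

Seen from the player to move, the game loses exactly if every child is bad for her: either the edge
ruins her, or it leaves her below `κ` and the opponent, now to move with the capitals exchanged,
wins. The pairs (edge weight, subtree) at the children are i.i.d. and their number has law `χ`, so
the probability that all children are bad is `G` of the probability that one is bad, and the latter
is an average over the edge weight. This gives `L_{n+1} = g(J - W_n)`. Negating the winning
condition gives a condition of the same shape, whence `J - W_{n+1} = g(L_n)`; the same holds without
the bound on the number of moves (`eventMatrix_eq_gMap` covers all four cases). So `g` exchanges `L`
and `J - W`, and `h = g ∘ g` fixes both.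

Moreover `L_{2n}` is the `n`-th iterate of `h` from `0`, and `J - W_{2n}` that from `J`. Since `g`
is antitone, `h` is monotone, so each fixed point stays between these iterates
(`resultMatrix_sandwich`) and, in the limit, between `L` and `J - W`. The draw matrix is the
difference `J - W - L` of the extreme fixed points, so it vanishes exactly if the fixed point is
unique. In that case `g(L) = J - W = L`, while any fixed point of `g` is one of `h`. -/

/-! ### Backward induction on a deterministic tree -/

/-- The verdict in favour of a player (`true` stands for the first player). -/
def wonBy : Bool → Verdict
  | true => Verdict.firstWon
  | false => Verdict.secondWon

/-- The player `b` is able to force a win from `s` within `n` moves. -/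
def Forces (κ : ℕ) (t : WeightedTree) (b : Bool) : ℕ → State → Prop
  | 0, s => verdict κ t s = wonBy b
  | n + 1, s => verdict κ t s = wonBy b ∨ verdict κ t s = Verdict.undecided ∧
      ((s.firstToMove = b ∧ ∃ k < t.numChildren s.token, Forces κ t b n (move t s k)) ∨
        (s.firstToMove ≠ b ∧ ∀ k < t.numChildren s.token, Forces κ t b n (move t s k)))

section

variable {κ : ℕ} {t : WeightedTree} {b : Bool}

theorem Forces.succ {n : ℕ} {s : State} (h : Forces κ t b n s) : Forces κ t b (n + 1) s := by
  induction n generalizing s with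
  | zero => exact Or.inl h
  | succ n ih =>
    rcases h with h | ⟨hu, ⟨hb, k, hk, h⟩ | ⟨hb, h⟩⟩
    · exact Or.inl h
    · exact Or.inr ⟨hu, Or.inl ⟨hb, k, hk, ih h⟩⟩
    · exact Or.inr ⟨hu, Or.inr ⟨hb, fun k hk => ih (h k hk)⟩⟩

theorem Forces.mono {m n : ℕ} (hmn : m ≤ n) {s : State} (h : Forces κ t b m s) :
    Forces κ t b n s := by
  induction hmn with
  | refl => exact h
  | step _ ih => exact ih.succ

/-- The quantifiers over moves are finite, so eventual wins can be chosen uniformly bounded. -/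
theorem exists_nat_forall_lt {Q : ℕ → ℕ → Prop} (hQ : ∀ k m n, m ≤ n → Q m k → Q n k) {M : ℕ}
    (h : ∀ k < M, ∃ n, Q n k) : ∃ n, ∀ k < M, Q n k := by
  choose! N hN using h
  exact ⟨(Finset.range M).sup N, fun k hk =>
    hQ k _ _ (Finset.le_sup (Finset.mem_range.2 hk)) (hN k hk)⟩

theorem exists_forces_of_forall {s : State} (hu : verdict κ t s = Verdict.undecided)
    (hb : s.firstToMove ≠ b)
    (h : ∀ k < t.numChildren s.token, ∃ n, Forces κ t b n (move t s k)) :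
    ∃ n, Forces κ t b n s := by
  obtain ⟨n, hn⟩ := exists_nat_forall_lt (Q := fun n k => Forces κ t b n (move t s k))
    (fun _ _ _ hmn h => h.mono hmn) h
  exact ⟨n + 1, Or.inr ⟨hu, Or.inr ⟨hb, hn⟩⟩⟩

/-- The situation at the vertex `u`, if the game starts in `s`, at the root. -/
def stateAt (t : WeightedTree) (s : State) (u : List ℕ) : State := u.foldl (move t) s

/-- A strategy sees only the vertex, whereas forcing a win is a property of the full state. The
invariant `stateAt t s₀ s.token = s`, preserved by every move, lets a strategy reconstruct the
state. -/
theorem stateAt_move {s₀ s : State} (hs : stateAt t s₀ s.token = s) (k : ℕ) :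
    stateAt t s₀ (move t s k).token = move t s k := by
  have : stateAt t s₀ (s.token ++ [k]) = move t (stateAt t s₀ s.token) k := by
    simp [stateAt]
  rw [hs] at this
  exact this

theorem gameRound_of_decided {σ₁ σ₂ : Strategy t} {s : State}
    (h : verdict κ t s ≠ Verdict.undecided) : gameRound κ t σ₁ σ₂ s = s := by
  unfold gameRound
  cases hv : verdict κ t s <;> simp_all

theorem gameRound_of_undecided {σ₁ σ₂ : Strategy t} {s : State}
    (h : verdict κ t s = Verdict.undecided) :
    gameRound κ t σ₁ σ₂ s = move t s (if s.firstToMove then σ₁.1 s.token else σ₂.1 s.token) := by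
  unfold gameRound
  rw [h]

theorem numChildren_ne_zero_of_undecided {s : State} (h : verdict κ t s = Verdict.undecided) :
    t.numChildren s.token ≠ 0 := by
  intro h0
  unfold verdict at h
  split_ifs at h

/-- The strategies of both players, given by that of the player `b` and that of her opponent. -/
def arrange (b : Bool) (σ τ : Strategy t) (c : Bool) : Strategy t := if c = b then σ else τ

open Classical in
/-- A strategy that makes `Q` true at the next vertex whenever this is possible. -/
theorem exists_strategy (t : WeightedTree) (Q : List ℕ → ℕ → Prop) :
    ∃ σ : Strategy t, ∀ u, (∃ k < t.numChildren u, Q u k) → Q u (σ.1 u) := by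
  refine ⟨⟨fun u => if h : ∃ k < t.numChildren u, Q u k then h.choose else 0, fun u hu => ?_⟩,
    fun u h => ?_⟩
  · dsimp only
    split_ifs with h
    · exact h.choose_spec.1
    · exact Nat.pos_of_ne_zero hu
  · simp only [dif_pos h]
    exact h.choose_spec.2

/-- Some strategy always reduces the number of moves within which a win can be forced. -/
theorem exists_strategy_of_forces (κ : ℕ) (t : WeightedTree) (b : Bool) (s₀ : State) :
    ∃ σ : Strategy t, ∀ u n, (∃ k < t.numChildren u, Forces κ t b n (move t (stateAt t s₀ u) k)) →
      Forces κ t b n (move t (stateAt t s₀ u) (σ.1 u)) := by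
  obtain ⟨σ, hσ⟩ := exists_strategy t fun u k => ∀ n,
    (∃ l < t.numChildren u, Forces κ t b n (move t (stateAt t s₀ u) l)) →
      Forces κ t b n (move t (stateAt t s₀ u) k)
  refine ⟨σ, fun u n h => hσ u ?_ n h⟩
  classical
  -- A child that can be won within the least possible number of moves is good for every larger
  -- bound at once, so the choice need not depend on `n`.
  have hex : ∃ n, ∃ k < t.numChildren u, Forces κ t b n (move t (stateAt t s₀ u) k) := ⟨n, h⟩
  obtain ⟨k, hk, hf⟩ := Nat.find_spec hex
  exact ⟨k, hk, fun m hm => hf.mono (Nat.find_min' hex hm)⟩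

/-- Each round lowers the bound by one: on her own turn the strategy `σ` picks a child that does so,
and on the opponent's turn every child does. -/
theorem forces_imp_wins {s₀ : State} {σ : Strategy t}
    (hσ : ∀ u n, (∃ k < t.numChildren u, Forces κ t b n (move t (stateAt t s₀ u) k)) →
      Forces κ t b n (move t (stateAt t s₀ u) (σ.1 u))) (τ : Strategy t) (n : ℕ) (s : State)
    (hs : stateAt t s₀ s.token = s) (h : Forces κ t b n s) :
    ∃ m, verdict κ t ((gameRound κ t (arrange b σ τ true) (arrange b σ τ false))^[m] s) =
      wonBy b := by
  induction n generalizing s with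
  | zero => exact ⟨0, h⟩
  | succ n ih =>
    rcases h with h | ⟨hu, h⟩
    · exact ⟨0, h⟩
    · suffices hf : Forces κ t b n (move t s (if s.firstToMove then
          (arrange b σ τ true).1 s.token else (arrange b σ τ false).1 s.token)) by
        obtain ⟨m, hm⟩ := ih _ (stateAt_move hs _) hf
        refine ⟨m + 1, ?_⟩
        rw [Function.iterate_succ_apply, gameRound_of_undecided hu]
        exact hm
      rcases h with ⟨hb, h⟩ | ⟨hb, h⟩
      · have := hσ s.token n (by rwa [hs])
        rw [hs] at this
        cases b <;> simpa [hb, arrange] using this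
      · have := h _ (τ.2 s.token (numChildren_ne_zero_of_undecided hu))
        cases b <;> simp at hb <;> simpa [hb, arrange] using this

/-- The opponent can keep the play among states from which `b` cannot force a win. If all her moves
led out of this set, the finitely many bounds would have a common upper bound, and `b` could already
force a win one move earlier. -/
theorem not_forces_imp_not_wins {s₀ : State} {τ : Strategy t}
    (hτ : ∀ u, (∃ k < t.numChildren u, ¬ ∃ n, Forces κ t b n (move t (stateAt t s₀ u) k)) →
      ¬ ∃ n, Forces κ t b n (move t (stateAt t s₀ u) (τ.1 u))) (σ : Strategy t) (m : ℕ) (s : State)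
    (hs : stateAt t s₀ s.token = s) (h : ¬ ∃ n, Forces κ t b n s) :
    verdict κ t ((gameRound κ t (arrange b σ τ true) (arrange b σ τ false))^[m] s) ≠
      wonBy b := by
  induction m generalizing s with
  | zero => exact fun h' => h ⟨0, h'⟩
  | succ m ih =>
    rw [Function.iterate_succ_apply]
    by_cases hu : verdict κ t s = Verdict.undecided
    · rw [gameRound_of_undecided hu]
      refine ih _ (stateAt_move hs _) ?_
      by_cases hb : s.firstToMove = b
      · rintro ⟨n, hn⟩
        refine h ⟨n + 1, Or.inr ⟨hu, Or.inl ⟨hb, _,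
          σ.2 s.token (numChildren_ne_zero_of_undecided hu), ?_⟩⟩⟩
        cases b <;> simpa [hb, arrange] using hn
      · have := hτ s.token (by
          rw [hs]
          by_contra hc
          push Not at hc
          exact h (exists_forces_of_forall hu hb hc))
        rw [hs] at this
        cases b <;> simp at hb <;> simpa [hb, arrange] using this
    · rw [gameRound_of_decided hu]
      exact ih s hs h

/-- A player has a winning strategy if and only if she can force a win in boundedly many moves. -/
theorem exists_winning_strategy_iff (κ : ℕ) (t : WeightedTree) (b : Bool) (s : State)
    (hs : s.token = []) :
    (∃ σ : Strategy t, ∀ τ : Strategy t, ∃ m,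
      verdict κ t ((gameRound κ t (arrange b σ τ true) (arrange b σ τ false))^[m] s) = wonBy b) ↔
      ∃ n, Forces κ t b n s := by
  have hs' : stateAt t s s.token = s := by rw [hs]; rfl
  constructor
  · rintro ⟨σ, hσ⟩
    by_contra h
    obtain ⟨τ, hτ⟩ := exists_strategy t fun u k =>
      ¬ ∃ n, Forces κ t b n (move t (stateAt t s u) k)
    obtain ⟨m, hm⟩ := hσ τ
    exact not_forces_imp_not_wins hτ σ m s hs' h hm
  · rintro ⟨n, hn⟩
    obtain ⟨σ, hσ⟩ := exists_strategy_of_forces κ t b s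
    exact ⟨σ, fun τ => forces_imp_wins hσ τ n s hs' hn⟩

theorem firstWins_iff_forces (κ : ℕ) (t : WeightedTree) (i j : ℕ) :
    FirstWins κ t [] i j ↔ ∃ n, Forces κ t true n ⟨[], i, j, true⟩ :=
  exists_winning_strategy_iff κ t true ⟨[], i, j, true⟩ rfl

theorem firstLoses_iff_forces (κ : ℕ) (t : WeightedTree) (i j : ℕ) :
    FirstLoses κ t [] i j ↔ ∃ n, Forces κ t false n ⟨[], i, j, true⟩ :=
  exists_winning_strategy_iff κ t false ⟨[], i, j, true⟩ rfl

/-! ### The recursion over subtrees -/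

/-- The subtree below the vertex `v`. -/
def subtreeAt (t : WeightedTree) (v : List ℕ) : WeightedTree := fun u => t (v ++ u)

/-- The subtree below the `k`-th child of the root. -/
def subtree (k : ℕ) (t : WeightedTree) : WeightedTree := fun u => t (k :: u)

theorem subtree_subtreeAt (t : WeightedTree) (v : List ℕ) (k : ℕ) :
    subtree k (subtreeAt t v) = subtreeAt t (v ++ [k]) := by
  funext u
  simp [subtree, subtreeAt]

/-- The weight attached to the root, which is the weight of the edge above it. -/
def rootWeight (t : WeightedTree) : ℤ := ((t []).2 : ℤ)

/-- `MoverResult κ w n t i j`: the player to move, with capital `i` against `j`, at the root of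
`t`, forces a win within `n` moves (for `w = true`), or is forced to lose (for `w = false`). -/
def MoverResult (κ : ℕ) : Bool → ℕ → WeightedTree → ℤ → ℤ → Prop
  | _, 0, _, _, _ => False
  | true, n + 1, t, i, j => ∃ k < (t []).1, κ ≤ i + rootWeight (subtree k t) ∨
      (0 < i + rootWeight (subtree k t) ∧
        MoverResult κ false n (subtree k t) j (i + rootWeight (subtree k t)))
  | false, n + 1, t, i, j => ∀ k < (t []).1, i + rootWeight (subtree k t) ≤ 0 ∨
      (i + rootWeight (subtree k t) < κ ∧
        MoverResult κ true n (subtree k t) j (i + rootWeight (subtree k t)))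

theorem MoverResult.succ {w : Bool} {n : ℕ} {t : WeightedTree} {i j : ℤ}
    (h : MoverResult κ w n t i j) : MoverResult κ w (n + 1) t i j := by
  induction n generalizing w t i j with
  | zero => cases w <;> exact h.elim
  | succ n ih =>
    cases w
    · exact fun k hk => (h k hk).imp_right (And.imp_right ih)
    · obtain ⟨k, hk, h⟩ := h
      exact ⟨k, hk, h.imp_right (And.imp_right ih)⟩

/-- The capitals of the mover and of the waiting player, as the first and second player. -/
def moverState (v : List ℕ) (i j : ℤ) (f : Bool) : State :=
  ⟨v, if f then i else j, if f then j else i, f⟩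

theorem move_moverState (t : WeightedTree) (v : List ℕ) (i j : ℤ) (f : Bool) (k : ℕ) :
    move t (moverState v i j f) k =
      moverState (v ++ [k]) j (i + rootWeight (subtree k (subtreeAt t v))) (!f) := by
  cases f <;> simp [move, moverState, rootWeight, subtree, subtreeAt, WeightedTree.weight]

theorem verdict_moverState_of_pos_lt (t : WeightedTree) (v : List ℕ) {i j : ℤ} (f : Bool)
    (hi : 0 < i ∧ i < κ) (hj : 0 < j ∧ j < κ) :
    verdict κ t (moverState v i j f) =
      if (subtreeAt t v []).1 = 0 then wonBy (!f) else Verdict.undecided := by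
  cases f <;>
    simp [verdict, moverState, hi.2.not_ge, hj.2.not_ge, hi.1.not_ge, hj.1.not_ge, wonBy,
      subtreeAt, WeightedTree.numChildren]

theorem verdict_moverState_of_ge (t : WeightedTree) (v : List ℕ) {i j : ℤ} (f : Bool)
    (hi : 0 < i ∧ i < κ) (hj : (κ : ℤ) ≤ j) :
    verdict κ t (moverState v i j f) = wonBy (!f) := by
  have : 0 < j := by omega
  cases f <;> simp [verdict, moverState, hi, hj, wonBy, this]

theorem verdict_moverState_of_le (t : WeightedTree) (v : List ℕ) {i j : ℤ} (f : Bool)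
    (hi : 0 < i ∧ i < κ) (hj : j ≤ 0) :
    verdict κ t (moverState v i j f) = wonBy f := by
  have : ¬ (κ : ℤ) ≤ j := by omega
  cases f <;> simp [verdict, moverState, hi, hj, wonBy, this]

theorem Forces.of_verdict {s : State} (h : verdict κ t s = wonBy b) (n : ℕ) : Forces κ t b n s := by
  cases n with
  | zero => exact h
  | succ n => exact Or.inl h

theorem not_forces_of_verdict {s : State} (h : verdict κ t s = wonBy (!b)) (n : ℕ) :
    ¬ Forces κ t b n s := by
  cases n <;> cases b <;> simp [Forces, h, wonBy]

/-- One induction treats both outcomes, since a move exchanges mover and waiter and turns a win of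
the one into a loss of the other. At a leaf the mover has already lost, in agreement with an empty
condition on children. -/
theorem forces_of_moverResult {w : Bool} {n : ℕ} {v : List ℕ} {i j : ℤ} {f : Bool}
    (hi : 0 < i ∧ i < κ) (hj : 0 < j ∧ j < κ) (h : MoverResult κ w n (subtreeAt t v) i j) :
    Forces κ t (if w then f else !f) n (moverState v i j f) := by
  induction n generalizing w v i j f with
  | zero => cases w <;> exact h.elim
  | succ n ih =>
    have hv := verdict_moverState_of_pos_lt t v f hi hj
    by_cases h0 : (subtreeAt t v []).1 = 0
    · rw [if_pos h0] at hv
      cases w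
      · exact Or.inl hv
      · obtain ⟨k, hk, -⟩ := h
        omega
    · rw [if_neg h0] at hv
      refine Or.inr ⟨hv, ?_⟩
      have hn : t.numChildren (moverState v i j f).token = (subtreeAt t v []).1 := by
        simp [moverState, WeightedTree.numChildren, subtreeAt]
      rw [hn]
      simp only [move_moverState]
      cases w
      · refine Or.inr ⟨by simp [moverState], fun k hk => ?_⟩
        rcases h k hk with h | ⟨h1, h⟩
        · exact Forces.of_verdict (verdict_moverState_of_le _ _ _ hj h) n
        -- The two alternatives in `MoverResult` overlap: the second one does not exclude that the
        -- mover is already ruined.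
        · by_cases h2 : i + rootWeight (subtree k (subtreeAt t v)) ≤ 0
          · exact Forces.of_verdict (verdict_moverState_of_le _ _ _ hj h2) n
          · rw [subtree_subtreeAt] at h h1 h2 ⊢
            exact ih (w := true) (f := !f) hj ⟨by omega, h1⟩ h
      · obtain ⟨k, hk, h⟩ := h
        refine Or.inl ⟨by simp [moverState], k, hk, ?_⟩
        rcases h with h | ⟨h1, h⟩
        · refine Forces.of_verdict ?_ n
          simpa using verdict_moverState_of_ge t (v ++ [k]) (!f) hj h
        · by_cases h2 : κ ≤ i + rootWeight (subtree k (subtreeAt t v))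
          · refine Forces.of_verdict ?_ n
            simpa using verdict_moverState_of_ge t (v ++ [k]) (!f) hj h2
          · rw [subtree_subtreeAt] at h h1 h2 ⊢
            have := ih (w := false) (f := !f) hj ⟨h1, by omega⟩ h
            simpa using this

theorem moverResult_succ_of_verdict {w : Bool} {v : List ℕ} {i j : ℤ} {f : Bool}
    (hi : 0 < i ∧ i < κ) (hj : 0 < j ∧ j < κ)
    (h : verdict κ t (moverState v i j f) = wonBy (if w then f else !f)) (n : ℕ) :
    MoverResult κ w (n + 1) (subtreeAt t v) i j := by
  rw [verdict_moverState_of_pos_lt t v f hi hj] at h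
  by_cases h0 : (subtreeAt t v []).1 = 0
  · cases w
    · intro k hk
      omega
    · cases f <;> simp [h0, wonBy] at h
  · cases w <;> cases f <;> simp [h0, wonBy] at h

/-- The bound grows by one because a loss at a leaf takes no move for `Forces`, while `MoverResult`
is false at level `0` and sees the leaf only at level `1`. -/
theorem moverResult_of_forces {w : Bool} {n : ℕ} {v : List ℕ} {i j : ℤ} {f : Bool}
    (hi : 0 < i ∧ i < κ) (hj : 0 < j ∧ j < κ)
    (h : Forces κ t (if w then f else !f) n (moverState v i j f)) :
    MoverResult κ w (n + 1) (subtreeAt t v) i j := by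
  induction n generalizing w v i j f with
  | zero => exact moverResult_succ_of_verdict hi hj h 0
  | succ n ih =>
    rcases h with h | ⟨hu, h⟩
    · exact moverResult_succ_of_verdict hi hj h _
    · have hn : t.numChildren (moverState v i j f).token = (subtreeAt t v []).1 := by
        simp [moverState, WeightedTree.numChildren, subtreeAt]
      have hf : (moverState v i j f).firstToMove = f := rfl
      rw [hn, hf] at h
      simp only [move_moverState] at h
      cases w
      · rcases h with ⟨h, -⟩ | ⟨-, h⟩
        · cases f <;> simp at h
        · intro k hk
          by_cases h1 : i + rootWeight (subtree k (subtreeAt t v)) ≤ 0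
          · exact Or.inl h1
          · have h := h k hk
            by_cases h2 : κ ≤ i + rootWeight (subtree k (subtreeAt t v))
            · refine absurd h (not_forces_of_verdict ?_ n)
              simpa using verdict_moverState_of_ge t (v ++ [k]) (!f) hj h2
            · refine Or.inr ⟨by omega, ?_⟩
              rw [subtree_subtreeAt] at h h1 h2 ⊢
              exact ih (w := true) (f := !f) hj ⟨by omega, by omega⟩ h
      · rcases h with ⟨-, k, hk, h⟩ | ⟨h, -⟩
        · refine ⟨k, hk, ?_⟩
          by_cases h1 : κ ≤ i + rootWeight (subtree k (subtreeAt t v))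
          · exact Or.inl h1
          · by_cases h2 : i + rootWeight (subtree k (subtreeAt t v)) ≤ 0
            · refine absurd h (not_forces_of_verdict ?_ n)
              simpa using verdict_moverState_of_le t (v ++ [k]) (!f) hj h2
            · refine Or.inr ⟨by omega, ?_⟩
              rw [subtree_subtreeAt] at h h1 h2 ⊢
              exact ih (w := false) (f := !f) hj ⟨by omega, by omega⟩ (by simpa using h)
        · simp at h

theorem exists_forces_iff {w : Bool} {i j : ℤ} (hi : 0 < i ∧ i < κ) (hj : 0 < j ∧ j < κ) :
    (∃ n, Forces κ t w n ⟨[], i, j, true⟩) ↔ ∃ n, MoverResult κ w n t i j := by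
  have hs : (⟨[], i, j, true⟩ : State) = moverState [] i j true := rfl
  rw [hs]
  constructor
  · rintro ⟨n, h⟩
    exact ⟨n + 1, moverResult_of_forces (v := []) (f := true) hi hj (by cases w <;> exact h)⟩
  · rintro ⟨n, h⟩
    have := forces_of_moverResult (v := []) (f := true) hi hj h
    exact ⟨n, by cases w <;> exact this⟩

theorem firstWins_iff_moverResult {i j : ℕ} (hi : 0 < i ∧ i < κ) (hj : 0 < j ∧ j < κ) :
    FirstWins κ t [] i j ↔ ∃ n, MoverResult κ true n t i j := by
  rw [firstWins_iff_forces]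
  exact exists_forces_iff (by exact_mod_cast hi) (by exact_mod_cast hj)

theorem firstLoses_iff_moverResult {i j : ℕ} (hi : 0 < i ∧ i < κ) (hj : 0 < j ∧ j < κ) :
    FirstLoses κ t [] i j ↔ ∃ n, MoverResult κ false n t i j := by
  rw [firstLoses_iff_forces]
  exact exists_forces_iff (by exact_mod_cast hi) (by exact_mod_cast hj)

theorem iterate_gameRound_of_decided {σ₁ σ₂ : Strategy t} {s : State}
    (h : verdict κ t s ≠ Verdict.undecided) (n : ℕ) : (gameRound κ t σ₁ σ₂)^[n] s = s :=
  Function.iterate_fixed (gameRound_of_decided h) n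

/-- Let the two winning strategies play each other: the earlier of the two verdicts is frozen and
contradicts the later one. -/
theorem not_firstWins_and_firstLoses (κ : ℕ) (t : WeightedTree) (v : List ℕ) (i j : ℕ) :
    ¬ (FirstWins κ t v i j ∧ FirstLoses κ t v i j) := by
  rintro ⟨⟨σ₁, h₁⟩, σ₂, h₂⟩
  obtain ⟨m, hm⟩ := h₁ σ₂
  obtain ⟨n, hn⟩ := h₂ σ₁
  have key : ∀ a c, a ≤ c → verdict κ t (play κ t v i j σ₁ σ₂ a) ≠ Verdict.undecided →
      play κ t v i j σ₁ σ₂ c = play κ t v i j σ₁ σ₂ a := by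
    intro a c hac ha
    obtain ⟨d, rfl⟩ := Nat.exists_eq_add_of_le' hac
    unfold play at ha ⊢
    rw [Function.iterate_add_apply, iterate_gameRound_of_decided ha]
  rcases le_total m n with h | h
  · rw [key m n h (by simp [hm]), hm] at hn
    cases hn
  · rw [key n m h (by simp [hn]), hn] at hm
    cases hm

end

/-! ### The branching property of the Galton–Watson tree -/

/-- The tree whose root carries the mark `x.1`, with the subtrees `x.2 k`. -/
def graft (x : (ℕ × SignType) × (ℕ → WeightedTree)) : WeightedTree
  | [] => x.1
  | k :: u => x.2 k u

theorem measurable_graft : Measurable graft := by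
  refine measurable_pi_lambda _ fun u => ?_
  cases u with
  | nil => exact measurable_fst
  | cons k u =>
    exact (measurable_pi_apply u).comp ((measurable_pi_apply k).comp measurable_snd)

theorem graft_preimage_pi (s : Finset (List ℕ)) (T : List ℕ → Set (ℕ × SignType)) :
    graft ⁻¹' (Set.pi s T) = {e | [] ∈ s → e ∈ T []} ×ˢ
      {τ : ℕ → WeightedTree | ∀ k u, k :: u ∈ s → τ k u ∈ T (k :: u)} := by
  ext ⟨e, τ⟩
  simp only [Set.mem_preimage, Set.mem_pi, Set.mem_prod, Set.mem_ofPred_eq, Finset.mem_coe]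
  constructor
  · exact fun h => ⟨h [], fun k u => h (k :: u)⟩
  · rintro ⟨h₁, h₂⟩ (_ | ⟨k, u⟩)
    · exact h₁
    · exact h₂ k u

instance (χ : PMF ℕ) (p : PMF SignType) : IsProbabilityMeasure (gwMeasure χ p) := by
  unfold gwMeasure
  infer_instance

/-- It suffices to compare finite boxes. Addresses are either `[]` or `k :: u`, so a box factors
into a condition on the root mark and one on the family of subtrees; a product over `ℕ` of products
over `List ℕ` is a product over the pairs. -/
theorem map_graft (χ : PMF ℕ) (p : PMF SignType) :
    ((χ.toMeasure.prod p.toMeasure).prod (Measure.infinitePi fun _ : ℕ => gwMeasure χ p)).map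
      graft = gwMeasure χ p := by
  refine Measure.eq_infinitePi _ fun s T hT => ?_
  set ν := χ.toMeasure.prod p.toMeasure
  rw [Measure.map_apply measurable_graft (.pi s.countable_toSet fun _ _ => hT _),
    graft_preimage_pi, Measure.prod_prod]
  classical
  have hB : MeasurableSet {τ : ℕ → WeightedTree | ∀ k u, k :: u ∈ s → τ k u ∈ T (k :: u)} := by
    refine measurableSet_setOfPred.2 ?_
    refine Measurable.forall fun k => Measurable.forall fun u => Measurable.imp measurable_const ?_
    exact measurableSet_setOfPred.1 (measurableSet_preimage
      ((measurable_pi_apply u).comp (measurable_pi_apply k)) (hT _))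
  have hinj : Function.Injective fun q : ℕ × List ℕ => q.1 :: q.2 := by
    rintro ⟨_, _⟩ ⟨_, _⟩ h
    simpa using h
  have h₁ : ν {e | [] ∈ s → e ∈ T []} = 
      ∏ u ∈ s with u ∉ Set.range fun q : ℕ × List ℕ => q.1 :: q.2, ν (T u) := by
    have : ∀ u : List ℕ, (u ∉ Set.range fun q : ℕ × List ℕ => q.1 :: q.2) ↔ u = [] := by
      intro u
      cases u <;> simp
    have hs : (s.filter fun u => u ∉ Set.range fun q : ℕ × List ℕ => q.1 :: q.2) =
        if [] ∈ s then {[]} else ∅ := by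
      ext u
      rw [Finset.mem_filter, this]
      split_ifs with h
      · simpa using fun hu : u = [] => hu ▸ h
      · simpa using fun hu (hu' : u = []) => h (hu' ▸ hu)
    rw [hs]
    by_cases h : [] ∈ s <;> simp [h]
  have h₂ : (Measure.infinitePi fun _ : ℕ => gwMeasure χ p)
      {τ : ℕ → WeightedTree | ∀ k u, k :: u ∈ s → τ k u ∈ T (k :: u)} =
      ∏ u ∈ s with u ∈ Set.range fun q : ℕ × List ℕ => q.1 :: q.2, ν (T u) := by
    have hc := Measure.infinitePi_map_curry (fun (_ : ℕ) (_ : List ℕ) => ν)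
    unfold gwMeasure
    rw [← hc, Measure.map_apply (MeasurableEquiv.measurable _) hB,
      ← Finset.prod_preimage' (fun q : ℕ × List ℕ => q.1 :: q.2) s hinj.injOn,
      ← Measure.infinitePi_pi (fun _ : ℕ × List ℕ => ν) (fun _ _ => hT _)]
    congr 1
    ext x
    simp [MeasurableEquiv.curry, Function.curry]
  rw [h₁, h₂, mul_comm, Finset.prod_filter_mul_prod_filter_not]

/-- The law of the family of subtrees together with the number of children of the root. -/
def branchMeasure (χ : PMF ℕ) (p : PMF SignType) : Measure (ℕ × (ℕ → WeightedTree)) :=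
  χ.toMeasure.prod (Measure.infinitePi fun _ : ℕ => gwMeasure χ p)

instance (χ : PMF ℕ) (p : PMF SignType) : IsProbabilityMeasure (branchMeasure χ p) := by
  unfold branchMeasure
  infer_instance

/-- The factors are regrouped so that the root weight stands apart from the number of children and
the subtrees. -/
theorem measurePreserving_graft (χ : PMF ℕ) (p : PMF SignType) :
    MeasurePreserving (fun x : SignType × (ℕ × (ℕ → WeightedTree)) => graft ((x.2.1, x.1), x.2.2))
      (p.toMeasure.prod (branchMeasure χ p)) (gwMeasure χ p) := by
  have h₁ : MeasurePreserving graft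
      ((χ.toMeasure.prod p.toMeasure).prod (Measure.infinitePi fun _ : ℕ => gwMeasure χ p))
      (gwMeasure χ p) := ⟨measurable_graft, map_graft χ p⟩
  have h₂ := (measurePreserving_prodAssoc p.toMeasure χ.toMeasure
    (Measure.infinitePi fun _ : ℕ => gwMeasure χ p)).symm
  have h₃ := (Measure.measurePreserving_swap (μ := p.toMeasure) (ν := χ.toMeasure)).prod
    (MeasurePreserving.id (Measure.infinitePi fun _ : ℕ => gwMeasure χ p))
  exact h₁.comp (h₃.comp h₂)

theorem measurable_subtree (k : ℕ) : Measurable (subtree k) :=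
  measurable_pi_lambda _ fun u => measurable_pi_apply (k :: u)

/-- Condition on the number `m` of children: the `m` subtrees are independent copies of the tree.
The root mark of a subtree holds the weight of the edge above it, so `A` may involve that edge too.
-/
theorem gwMeasure_forall_subtree (χ : PMF ℕ) (p : PMF SignType) {A : Set WeightedTree}
    (hA : MeasurableSet A) :
    gwMeasure χ p {t | ∀ k < (t []).1, subtree k t ∈ A} = ∑' m, gwMeasure χ p A ^ m * χ m := by
  have hS : ∀ m, MeasurableSet {τ : ℕ → WeightedTree | ∀ k < m, τ k ∈ A} := by
    intro m
    refine measurableSet_setOfPred.2 (Measurable.forall fun k => Measurable.imp measurable_const ?_)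
    exact measurableSet_setOfPred.1 (measurableSet_preimage (measurable_pi_apply k) hA)
  have hS' : MeasurableSet {x : ℕ × (ℕ → WeightedTree) | ∀ k < x.1, x.2 k ∈ A} :=
    measurableSet_setOfPred.2 (measurable_from_prod_countable_right
      fun m => measurableSet_setOfPred.1 (hS m))
  have hT : MeasurableSet {t : WeightedTree | ∀ k < (t []).1, subtree k t ∈ A} := by
    have : {t : WeightedTree | ∀ k < (t []).1, subtree k t ∈ A} =
      (fun t => ((t []).1, fun k => subtree k t)) ⁻¹'
        {x : ℕ × (ℕ → WeightedTree) | ∀ k < x.1, x.2 k ∈ A} := rfl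
    rw [this]
    exact measurableSet_preimage ((measurable_fst.comp (measurable_pi_apply [])).prodMk
      (measurable_pi_lambda _ fun k => measurable_subtree k)) hS'
  rw [← (measurePreserving_graft χ p).measure_preimage hT.nullMeasurableSet]
  have : (fun x : SignType × (ℕ × (ℕ → WeightedTree)) => graft ((x.2.1, x.1), x.2.2)) ⁻¹'
      {t | ∀ k < (t []).1, subtree k t ∈ A} =
      Set.univ ×ˢ {x : ℕ × (ℕ → WeightedTree) | ∀ k < x.1, x.2 k ∈ A} := by
    ext x
    simp only [Set.mem_preimage, Set.mem_ofPred_eq, Set.mem_prod, Set.mem_univ, true_and]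
    rfl
  rw [this, Measure.prod_prod, measure_univ, one_mul, branchMeasure, Measure.prod_apply hS',
    lintegral_countable']
  refine tsum_congr fun m => ?_
  rw [PMF.toMeasure_apply_singleton _ _ (measurableSet_singleton m)]
  congr 1
  have := Measure.infinitePi_pi (fun _ : ℕ => gwMeasure χ p) (s := Finset.range m)
    (t := fun _ => A) (fun _ _ => hA)
  rw [Finset.prod_const, Finset.card_range] at this
  rw [← this]
  congr 1
  ext τ
  simp

theorem gwMeasure_real_forall_subtree (χ : PMF ℕ) (p : PMF SignType) {A : Set WeightedTree}
    (hA : MeasurableSet A) :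
    (gwMeasure χ p).real {t | ∀ k < (t []).1, subtree k t ∈ A} =
      pgf χ ((gwMeasure χ p).real A) := by
  rw [measureReal_def, gwMeasure_forall_subtree χ p hA, ENNReal.tsum_toReal_eq]
  · simp [pgf, measureReal_def]
  · exact fun m => ENNReal.mul_ne_top (ENNReal.pow_ne_top (measure_ne_top _ _)) (χ.apply_ne_top m)

/-- The tree `t`, with the weight `s` at the root. -/
def setRootWeight (t : WeightedTree) (s : SignType) : WeightedTree :=
  Function.update t [] ((t []).1, s)

/-- The weight at the root is independent of everything else. -/
theorem gwMeasure_real_rootWeight (χ : PMF ℕ) (p : PMF SignType) {B : SignType → Set WeightedTree}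
    (hB : ∀ s, MeasurableSet (B s)) (hinv : ∀ s t s', setRootWeight t s' ∈ B s ↔ t ∈ B s) :
    (gwMeasure χ p).real {t | t ∈ B (t []).2} = ∑ s, prob p s * (gwMeasure χ p).real (B s) := by
  set Φ := fun x : SignType × (ℕ × (ℕ → WeightedTree)) => graft ((x.2.1, x.1), x.2.2) with hΦ
  have hmp : MeasurePreserving Φ _ _ := measurePreserving_graft χ p
  have hD : MeasurableSet {t : WeightedTree | t ∈ B (t []).2} := by
    have : {t : WeightedTree | t ∈ B (t []).2} =
        ⋃ s, {t : WeightedTree | (t []).2 = s} ∩ B s := by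
      ext t
      simp
    rw [this]
    exact MeasurableSet.iUnion fun s => (measurableSet_preimage
      (measurable_snd.comp (measurable_pi_apply [])) (measurableSet_singleton s)).inter (hB s)
  -- As `B s` ignores the root weight, its preimage is a full product in that coordinate.
  have hC : ∀ s s' x, Φ (s', x) ∈ B s ↔ Φ (s, x) ∈ B s := by
    intro s s' x
    rw [← hinv s (Φ (s', x)) s]
    have : setRootWeight (Φ (s', x)) s = Φ (s, x) := by
      funext u
      cases u <;> simp [setRootWeight, hΦ, graft]
    rw [this]
  have hsec : ∀ s, branchMeasure χ p {x | Φ (s, x) ∈ B s} = gwMeasure χ p (B s) := by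
    intro s
    rw [← hmp.measure_preimage (hB s).nullMeasurableSet]
    have : Φ ⁻¹' B s = Set.univ ×ˢ {x | Φ (s, x) ∈ B s} := by
      ext ⟨s', x⟩
      simp [hC s s' x]
    rw [this, Measure.prod_prod, measure_univ, one_mul]
  have : gwMeasure χ p {t | t ∈ B (t []).2} = ∑ s, gwMeasure χ p (B s) * p s := by
    rw [← hmp.measure_preimage hD.nullMeasurableSet,
      Measure.prod_apply (measurableSet_preimage hmp.measurable hD), lintegral_fintype]
    refine Finset.sum_congr rfl fun s _ => ?_
    rw [PMF.toMeasure_apply_singleton _ _ (measurableSet_singleton s), ← hsec]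
    rfl
  rw [measureReal_def, this, ENNReal.toReal_sum fun s _ =>
    ENNReal.mul_ne_top (measure_ne_top _ _) (p.apply_ne_top s)]
  simp [prob, measureReal_def, mul_comm]

/-! ### The generating function and the map `g` -/

theorem prob_nonneg (p : PMF SignType) (s : SignType) : 0 ≤ prob p s := ENNReal.toReal_nonneg

theorem sum_prob (p : PMF SignType) : ∑ s, prob p s = 1 := by
  unfold prob
  rw [← ENNReal.toReal_sum fun s _ => p.apply_ne_top s,
    (tsum_fintype fun s => p s).symm.trans p.tsum_coe, ENNReal.toReal_one]

theorem hasSum_toReal (χ : PMF ℕ) : HasSum (fun m => (χ m).toReal) 1 := by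
  have h := (ENNReal.summable_toReal (f := χ) (by simp [χ.tsum_coe])).hasSum
  rwa [← ENNReal.tsum_toReal_eq fun m => χ.apply_ne_top m, χ.tsum_coe, ENNReal.toReal_one] at h

theorem summable_pgf (χ : PMF ℕ) {x : ℝ} (hx : x ∈ Set.Icc (0 : ℝ) 1) :
    Summable fun m : ℕ => x ^ m * (χ m).toReal :=
  (hasSum_toReal χ).summable.of_nonneg_of_le
    (fun _ => mul_nonneg (pow_nonneg hx.1 _) ENNReal.toReal_nonneg)
    fun _ => mul_le_of_le_one_left ENNReal.toReal_nonneg (pow_le_one₀ hx.1 hx.2)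

theorem pgf_mem_Icc (χ : PMF ℕ) {x : ℝ} (hx : x ∈ Set.Icc (0 : ℝ) 1) :
    pgf χ x ∈ Set.Icc (0 : ℝ) 1 := by
  refine ⟨tsum_nonneg fun _ => mul_nonneg (pow_nonneg hx.1 _) ENNReal.toReal_nonneg, ?_⟩
  rw [← (hasSum_toReal χ).tsum_eq]
  exact (summable_pgf χ hx).tsum_le_tsum
    (fun _ => mul_le_of_le_one_left ENNReal.toReal_nonneg (pow_le_one₀ hx.1 hx.2))
    (hasSum_toReal χ).summable

theorem pgf_le_pgf (χ : PMF ℕ) {x y : ℝ} (hx : x ∈ Set.Icc (0 : ℝ) 1) (hy : y ∈ Set.Icc (0 : ℝ) 1)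
    (hxy : x ≤ y) : pgf χ x ≤ pgf χ y :=
  (summable_pgf χ hx).tsum_le_tsum
    (fun _ => mul_le_mul_of_nonneg_right (pow_le_pow_left₀ hx.1 hxy _) ENNReal.toReal_nonneg)
    (summable_pgf χ hy)

/-- The expectation of `F`, evaluated at the capital after a move, where capitals that are not
positive count as `1` and capitals of at least `κ` as `0`. -/
def stepMean (κ : ℕ) (p : PMF SignType) (i : ℤ) (F : ℤ → ℝ) : ℝ :=
  ∑ s : SignType, prob p s * (if i + s ≤ 0 then 1 else if i + s < κ then F (i + s) else 0)

theorem stepMean_mem_Icc (κ : ℕ) (p : PMF SignType) (i : ℤ) {F : ℤ → ℝ}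
    (hF : ∀ a : ℤ, 0 < a → a < κ → F a ∈ Set.Icc (0 : ℝ) 1) :
    stepMean κ p i F ∈ Set.Icc (0 : ℝ) 1 := by
  have h : ∀ s : SignType,
      (if i + s ≤ 0 then 1 else if i + s < κ then F (i + s) else 0) ∈ Set.Icc (0 : ℝ) 1 := by
    intro s
    split_ifs with h₁ h₂
    · simp
    · exact hF _ (not_le.1 h₁) h₂
    · simp
  refine ⟨Finset.sum_nonneg fun s _ => mul_nonneg (prob_nonneg p s) (h s).1, ?_⟩
  rw [← sum_prob p]
  exact Finset.sum_le_sum fun s _ => mul_le_of_le_one_right (prob_nonneg p s) (h s).2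

theorem stepMean_le_stepMean (κ : ℕ) (p : PMF SignType) (i : ℤ) {F F' : ℤ → ℝ}
    (hF : ∀ a : ℤ, 0 < a → a < κ → F a ≤ F' a) : stepMean κ p i F ≤ stepMean κ p i F' := by
  refine Finset.sum_le_sum fun s _ => mul_le_mul_of_nonneg_left ?_ (prob_nonneg p s)
  split_ifs with h₁ h₂
  · exact le_rfl
  · exact hF _ (not_le.1 h₁) h₂
  · exact le_rfl

theorem sum_fin_ite_eq (n : ℕ) (a : ℤ) (F : ℤ → ℝ) :
    (∑ k : Fin n, if (k : ℤ) + 1 = a then F (k + 1) else 0) =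
      if 0 < a ∧ a < n + 1 then F a else 0 := by
  split_ifs with h
  · obtain ⟨m, rfl⟩ : ∃ m : ℕ, a = m + 1 := ⟨(a - 1).toNat, by omega⟩
    rw [Finset.sum_eq_single ⟨m, by omega⟩]
    · simp
    · intro k _ hk
      rw [if_neg]
      intro hk'
      exact hk (Fin.ext (by simpa using hk'))
    · simp
  · refine Finset.sum_eq_zero fun k _ => if_neg ?_
    have := k.2
    omega

/-- Index `k` stands for capital `k + 1`. The `e₁` term accounts for a drop from capital `1` to `0`,
where the value is `1`; a rise to `n + 1` falls outside the matrix and contributes `0`. -/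
theorem stepMatrix_sum (n : ℕ) (p : PMF SignType) (i : Fin n) (F : ℤ → ℝ) :
    prob p (-1) * firstVec n i + ∑ k, stepMatrix n p i k * F (k + 1) =
      stepMean (n + 1) p (i + 1) F := by
  have hi := i.2
  have : ∀ k : Fin n, stepMatrix n p i k * F (k + 1) =
      prob p (-1) * (if (k : ℤ) + 1 = i then F (k + 1) else 0) +
      prob p 0 * (if (k : ℤ) + 1 = i + 1 then F (k + 1) else 0) +
      prob p 1 * (if (k : ℤ) + 1 = i + 1 + 1 then F (k + 1) else 0) := by
    intro k
    simp only [stepMatrix, Matrix.of_apply, Fin.ext_iff]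
    split_ifs <;> first | omega | ring
  simp only [this, Finset.sum_add_distrib, ← Finset.mul_sum, sum_fin_ite_eq]
  have hu : (Finset.univ : Finset SignType) = {0, -1, 1} := rfl
  rw [stepMean, hu, Finset.sum_insert (by decide), Finset.sum_insert (by decide),
    Finset.sum_singleton]
  simp only [firstVec, SignType.coe_zero, SignType.coe_one, SignType.coe_neg, Nat.cast_add,
    Nat.cast_one]
  have h₀ : (0 : ℤ) < i + 1 ∧ (i : ℤ) + 1 < n + 1 := by omega
  have h₁ : (i : ℤ) + 1 + -1 = i := by ring
  have h₂ : ¬ ((i : ℤ) + 1 ≤ 0) ∧ ¬ ((i : ℤ) + 1 + 1 ≤ 0) := by omega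
  have h₃ : (0 : ℤ) < i + 1 + 1 := by omega
  simp only [h₀, h₁, h₂, h₃, add_zero, true_and, if_true, if_false, and_self]
  by_cases hi₀ : (i : ℕ) = 0
  · simp only [hi₀, if_true, Nat.cast_zero, le_refl, lt_irrefl, false_and, if_false]
    ring
  · have h₄ : ¬ ((i : ℤ) ≤ 0) ∧ (0 : ℤ) < i ∧ (i : ℤ) < n + 1 := by omega
    simp only [hi₀, h₄, if_true, if_false, and_self]
    ring

/-- The transpose reflects the change of turns: after the move the opponent's capital `j` comes
first, so row `j` of `X` enters, evaluated at the mover's new capital. -/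
theorem gMap_apply {κ : ℕ} (hκ : 0 < κ) (χ : PMF ℕ) (p : PMF SignType)
    (X : Matrix (Fin (κ - 1)) (Fin (κ - 1)) ℝ) (i j : Fin (κ - 1)) (F : ℤ → ℝ)
    (hF : ∀ k : Fin (κ - 1), F (k + 1) = 1 - X j k) :
    gMap χ p X i j = pgf χ (stepMean κ p (i + 1) F) := by
  have h := stepMatrix_sum (κ - 1) p i F
  rw [Nat.sub_add_cancel hκ] at h
  rw [← h]
  simp [gMap, fMap, Matrix.mul_apply, onesMatrix, hF]

/-- The function on capitals given by the entries of a vector. -/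
def ofCapital {n : ℕ} (y : Fin n → ℝ) : ℤ → ℝ :=
  Function.extend (fun k : Fin n => (k : ℤ) + 1) y 0

theorem ofCapital_apply {n : ℕ} (y : Fin n → ℝ) (k : Fin n) : ofCapital y (k + 1) = y k :=
  Function.Injective.extend_apply (f := fun k : Fin n => (k : ℤ) + 1)
    (fun a b h => Fin.ext (by simpa using h)) y 0 k

theorem exists_fin_of_capital {κ : ℕ} {a : ℤ} (h₀ : 0 < a) (h₁ : a < κ) :
    ∃ k : Fin (κ - 1), a = k + 1 :=
  ⟨⟨(a - 1).toNat, by omega⟩, by simp; omega⟩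

theorem gMap_mem {κ : ℕ} (hκ : 0 < κ) (χ : PMF ℕ) (p : PMF SignType)
    {X : Matrix (Fin (κ - 1)) (Fin (κ - 1)) ℝ} (hX : X ∈ unitMatrices (κ - 1)) :
    gMap χ p X ∈ unitMatrices (κ - 1) := by
  intro i j
  rw [gMap_apply hκ χ p X i j _ (ofCapital_apply fun k => 1 - X j k)]
  refine pgf_mem_Icc χ (stepMean_mem_Icc κ p _ fun a h₀ h₁ => ?_)
  obtain ⟨k, rfl⟩ := exists_fin_of_capital h₀ h₁
  rw [ofCapital_apply]
  have := hX j k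
  exact ⟨by linarith [this.2], by linarith [this.1]⟩

theorem gMap_antitone {κ : ℕ} (hκ : 0 < κ) (χ : PMF ℕ) (p : PMF SignType)
    {X Y : Matrix (Fin (κ - 1)) (Fin (κ - 1)) ℝ} (hX : X ∈ unitMatrices (κ - 1))
    (hY : Y ∈ unitMatrices (κ - 1)) (hXY : ∀ i j, X i j ≤ Y i j) (i j : Fin (κ - 1)) :
    gMap χ p Y i j ≤ gMap χ p X i j := by
  rw [gMap_apply hκ χ p X i j _ (ofCapital_apply fun k => 1 - X j k),
    gMap_apply hκ χ p Y i j _ (ofCapital_apply fun k => 1 - Y j k)]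
  refine pgf_le_pgf χ (stepMean_mem_Icc κ p _ fun a h₀ h₁ => ?_)
    (stepMean_mem_Icc κ p _ fun a h₀ h₁ => ?_) (stepMean_le_stepMean κ p _ fun a h₀ h₁ => ?_)
  all_goals obtain ⟨k, rfl⟩ := exists_fin_of_capital h₀ h₁
  · rw [ofCapital_apply]
    have := hY j k
    exact ⟨by linarith [this.2], by linarith [this.1]⟩
  · rw [ofCapital_apply]
    have := hX j k
    exact ⟨by linarith [this.2], by linarith [this.1]⟩
  · rw [ofCapital_apply, ofCapital_apply]
    linarith [hXY j k]

/-- Entrywise application of `G` commutes with transposition, so the inner bracket of `h` is the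
transpose of the one in `g`. -/
theorem hMap_eq_gMap_gMap {n : ℕ} (χ : PMF ℕ) (p : PMF SignType) (X : Matrix (Fin n) (Fin n) ℝ) :
    hMap χ p X = gMap χ p (gMap χ p X) := by
  have hJ : (onesMatrix n).transpose = onesMatrix n := rfl
  simp only [hMap, gMap, fMap, ← Matrix.transpose_map, Matrix.transpose_add, Matrix.transpose_smul,
    Matrix.transpose_vecMulVec, Matrix.transpose_mul, Matrix.transpose_sub,
    Matrix.transpose_transpose, hJ]

/-! ### Recursion for the outcome probabilities -/

/-- The probabilities of an event that depends on the capitals. -/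
def eventMatrix (κ : ℕ) (χ : PMF ℕ) (p : PMF SignType) (V : WeightedTree → ℤ → ℤ → Prop) :
    Matrix (Fin (κ - 1)) (Fin (κ - 1)) ℝ :=
  Matrix.of fun i j => (gwMeasure χ p).real {t | V t (i + 1) (j + 1)}

theorem measurable_of_rootWeight {Q : ℤ → WeightedTree → Prop} (hQ : ∀ s, Measurable (Q s)) :
    Measurable fun t => Q (rootWeight t) t := by
  have : (fun t => Q (rootWeight t) t) = fun t => ∃ s : SignType, (t []).2 = s ∧ Q s t := by
    funext t
    simp [rootWeight]
  rw [this]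
  refine Measurable.exists fun s => Measurable.and ?_ (hQ s)
  exact measurableSet_setOfPred.1 (measurableSet_preimage
    (measurable_snd.comp (measurable_pi_apply [])) (measurableSet_singleton s))

theorem subtree_setRootWeight (k : ℕ) (t : WeightedTree) (s : SignType) :
    subtree k (setRootWeight t s) = subtree k t := by
  funext u
  simp [subtree, setRootWeight]

theorem setRootWeight_nil_fst (t : WeightedTree) (s : SignType) :
    (setRootWeight t s []).1 = (t []).1 := by
  simp [setRootWeight]

/-- The common step behind all recursions. The children satisfy the condition independently, which
gives `G` of the probability for one child. That condition is then averaged over the edge weight,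
which is independent of `V'` because, by `hinv`, `V'` ignores the mark at the root of the subtree.
-/
theorem eventMatrix_eq_gMap {κ : ℕ} (hκ : 0 < κ) (χ : PMF ℕ) (p : PMF SignType)
    {V V' : WeightedTree → ℤ → ℤ → Prop} (hV' : ∀ i j, Measurable fun t => V' t i j)
    (hinv : ∀ t s i j, V' (setRootWeight t s) i j ↔ V' t i j)
    (hV : ∀ t i j, V t i j ↔ ∀ k < (t []).1, i + rootWeight (subtree k t) ≤ 0 ∨
      (i + rootWeight (subtree k t) < κ ∧ V' (subtree k t) j (i + rootWeight (subtree k t)))) :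
    eventMatrix κ χ p V = gMap χ p (onesMatrix (κ - 1) - eventMatrix κ χ p V') := by
  ext i j
  rw [gMap_apply hκ χ p _ i j (fun a => (gwMeasure χ p).real {t | V' t (j + 1) a})
    (fun k => by simp [onesMatrix, eventMatrix])]
  simp only [eventMatrix, Matrix.of_apply, hV]
  set Q : ℤ → WeightedTree → Prop := fun s t =>
    (i : ℤ) + 1 + s ≤ 0 ∨ ((i : ℤ) + 1 + s < κ ∧ V' t (j + 1) (i + 1 + s)) with hQ
  have hQm : ∀ s, Measurable (Q s) := fun s =>
    measurable_const.or (measurable_const.and (hV' _ _))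
  have h := gwMeasure_real_forall_subtree χ p (A := {t | Q (rootWeight t) t})
    (measurableSet_setOfPred.2 (measurable_of_rootWeight hQm))
  have h' := gwMeasure_real_rootWeight χ p (B := fun s => {t | Q s t})
    (fun s => measurableSet_setOfPred.2 (hQm s)) (fun s t s' => by simp [hQ, hinv])
  refine h.trans (congrArg (pgf χ) (h'.trans ?_))
  refine Finset.sum_congr rfl fun s _ => ?_
  congr 1
  simp only [hQ]
  split_ifs <;> simp [*]

theorem eventMatrix_not {κ : ℕ} (χ : PMF ℕ) (p : PMF SignType)
    {V : WeightedTree → ℤ → ℤ → Prop} (hV : ∀ i j, Measurable fun t => V t i j) :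
    eventMatrix κ χ p (fun t i j => ¬ V t i j) =
      onesMatrix (κ - 1) - eventMatrix κ χ p V := by
  ext i j
  have := probReal_compl_eq_one_sub (μ := gwMeasure χ p)
    (measurableSet_setOfPred.2 (hV (i + 1) (j + 1)))
  exact this

theorem eventMatrix_mem (κ : ℕ) (χ : PMF ℕ) (p : PMF SignType)
    (V : WeightedTree → ℤ → ℤ → Prop) : eventMatrix κ χ p V ∈ unitMatrices (κ - 1) :=
  fun _ _ => ⟨measureReal_nonneg, measureReal_le_one⟩

/-! ### Measurability and recursions for outcomes with and without a bound on the number of moves -/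

/-- The player to move wins (`w = true`) or loses (`w = false`) in a bounded number of moves. -/
def MoverResultEventually (κ : ℕ) (w : Bool) (t : WeightedTree) (i j : ℤ) : Prop :=
  ∃ n, MoverResult κ w n t i j

theorem measurable_moverResult (κ : ℕ) (w : Bool) (n : ℕ) (i j : ℤ) :
    Measurable fun t => MoverResult κ w n t i j := by
  have hc : ∀ k : ℕ, Measurable fun t : WeightedTree => k < (t []).1 := fun k =>
    (measurable_of_countable fun x : ℕ × SignType => k < x.1).comp (measurable_pi_apply [])
  induction n generalizing w i j with
  | zero => cases w <;> exact measurable_const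
  | succ n ih =>
    cases w
    · refine Measurable.forall fun k => (hc k).imp ?_
      refine (measurable_of_rootWeight (Q := fun s t => i + s ≤ 0 ∨ (i + s < κ ∧
        MoverResult κ true n t j (i + s))) fun s => ?_).comp (measurable_subtree k)
      exact measurable_const.or (measurable_const.and (ih _ _ _))
    · refine Measurable.exists fun k => (hc k).and ?_
      refine (measurable_of_rootWeight (Q := fun s t => κ ≤ i + s ∨ (0 < i + s ∧
        MoverResult κ false n t j (i + s))) fun s => ?_).comp (measurable_subtree k)
      exact measurable_const.or (measurable_const.and (ih _ _ _))

theorem measurable_moverResultEventually (κ : ℕ) (w : Bool) (i j : ℤ) :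
    Measurable fun t => MoverResultEventually κ w t i j :=
  Measurable.exists fun n => measurable_moverResult κ w n i j

theorem moverResult_setRootWeight (κ : ℕ) (w : Bool) (n : ℕ) (t : WeightedTree) (s : SignType)
    (i j : ℤ) : MoverResult κ w n (setRootWeight t s) i j ↔ MoverResult κ w n t i j := by
  cases n with
  | zero => cases w <;> exact Iff.rfl
  | succ n => cases w <;> simp only [MoverResult, subtree_setRootWeight, setRootWeight_nil_fst]

theorem MoverResult.mono {κ : ℕ} {w : Bool} {m n : ℕ} (hmn : m ≤ n) {t : WeightedTree} {i j : ℤ}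
    (h : MoverResult κ w m t i j) : MoverResult κ w n t i j := by
  induction hmn with
  | refl => exact h
  | step _ ih => exact ih.succ

theorem moverResultEventually_false_iff (κ : ℕ) (t : WeightedTree) (i j : ℤ) :
    MoverResultEventually κ false t i j ↔ ∀ k < (t []).1, i + rootWeight (subtree k t) ≤ 0 ∨
      (i + rootWeight (subtree k t) < κ ∧
        MoverResultEventually κ true (subtree k t) j (i + rootWeight (subtree k t))) := by
  constructor
  · rintro ⟨_ | n, h⟩
    · exact h.elim
    · exact fun k hk => (h k hk).imp_right (And.imp_right fun h => ⟨n, h⟩)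
  · intro h
    -- Finite branching is essential here: the bounds for the individual children have a common
    -- upper bound.
    obtain ⟨n, hn⟩ := exists_nat_forall_lt (M := (t []).1)
      (Q := fun n k => i + rootWeight (subtree k t) ≤ 0 ∨ (i + rootWeight (subtree k t) < κ ∧
        MoverResult κ true n (subtree k t) j (i + rootWeight (subtree k t))))
      (fun k m n hmn h => h.imp_right (And.imp_right (MoverResult.mono hmn)))
      (fun k hk => by
        rcases h k hk with h | ⟨h, n, hn⟩
        · exact ⟨0, Or.inl h⟩
        · exact ⟨n, Or.inr ⟨h, hn⟩⟩)
    exact ⟨n + 1, hn⟩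

theorem moverResultEventually_true_iff (κ : ℕ) (t : WeightedTree) (i j : ℤ) :
    MoverResultEventually κ true t i j ↔ ∃ k < (t []).1, κ ≤ i + rootWeight (subtree k t) ∨
      (0 < i + rootWeight (subtree k t) ∧
        MoverResultEventually κ false (subtree k t) j (i + rootWeight (subtree k t))) := by
  constructor
  · rintro ⟨_ | n, h⟩
    · exact h.elim
    · obtain ⟨k, hk, h⟩ := h
      exact ⟨k, hk, h.imp_right (And.imp_right fun h => ⟨n, h⟩)⟩
  · rintro ⟨k, hk, h | ⟨h, n, hn⟩⟩
    · exact ⟨1, k, hk, Or.inl h⟩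
    · exact ⟨n + 1, k, hk, Or.inr ⟨h, hn⟩⟩

/-- The negation of the winning condition has the shape of the losing condition, so
`eventMatrix_eq_gMap` applies to "does not win" as well. Positivity of `κ` is what makes a ruined
player fall short of `κ`. -/
theorem not_exists_child_iff {κ : ℕ} (hκ : 0 < κ) {M : ℕ} {a : ℕ → ℤ} {Q : ℕ → Prop} :
    (¬ ∃ k < M, κ ≤ a k ∨ (0 < a k ∧ Q k)) ↔ ∀ k < M, a k ≤ 0 ∨ (a k < κ ∧ ¬ Q k) := by
  push Not
  refine forall₂_congr fun k _ => ?_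
  constructor
  · rintro ⟨h₁, h₂⟩
    by_cases h : a k ≤ 0
    · exact Or.inl h
    · exact Or.inr ⟨h₁, h₂ (not_le.1 h)⟩
  · rintro (h | ⟨h₁, h₂⟩)
    · exact ⟨by omega, fun h' => absurd h (not_le.2 h')⟩
    · exact ⟨h₁, fun _ => h₂⟩

/-- The probabilities of a win or a loss of the first player within `n` moves. -/
def resultMatrix (κ : ℕ) (χ : PMF ℕ) (p : PMF SignType) (w : Bool) (n : ℕ) :
    Matrix (Fin (κ - 1)) (Fin (κ - 1)) ℝ :=
  eventMatrix κ χ p (MoverResult κ w n)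

theorem resultMatrix_zero (κ : ℕ) (χ : PMF ℕ) (p : PMF SignType) (w : Bool) :
    resultMatrix κ χ p w 0 = 0 := by
  ext i j
  cases w <;> simp [resultMatrix, eventMatrix, MoverResult]

theorem resultMatrix_false_succ {κ : ℕ} (hκ : 0 < κ) (χ : PMF ℕ) (p : PMF SignType) (n : ℕ) :
    resultMatrix κ χ p false (n + 1) =
      gMap χ p (onesMatrix (κ - 1) - resultMatrix κ χ p true n) :=
  eventMatrix_eq_gMap hκ χ p (fun i j => measurable_moverResult κ true n i j)
    (moverResult_setRootWeight κ true n) fun _ _ _ => Iff.rfl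

theorem ones_sub_resultMatrix_true_succ {κ : ℕ} (hκ : 0 < κ) (χ : PMF ℕ) (p : PMF SignType)
    (n : ℕ) :
    onesMatrix (κ - 1) - resultMatrix κ χ p true (n + 1) =
      gMap χ p (resultMatrix κ χ p false n) := by
  have h := eventMatrix_eq_gMap hκ χ p
    (V := fun t i j => ¬ MoverResult κ true (n + 1) t i j)
    (V' := fun t i j => ¬ MoverResult κ false n t i j)
    (fun i j => (measurable_moverResult κ false n i j).not)
    (fun t s i j => not_congr (moverResult_setRootWeight κ false n t s i j))
    (fun _ _ _ => not_exists_child_iff hκ)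
  rw [eventMatrix_not χ p (measurable_moverResult κ true (n + 1)),
    eventMatrix_not χ p (measurable_moverResult κ false n), sub_sub_cancel] at h
  exact h

/-! ### The map `g` exchanges `L` and `J - W` -/

variable {κ : ℕ} (χ : PMF ℕ) (p : PMF SignType)

theorem firstLoses_iff_eventually (i j : Fin (κ - 1)) (t : WeightedTree) :
    FirstLoses κ t [] (i + 1) (j + 1) ↔ MoverResultEventually κ false t (i + 1) (j + 1) := by
  have hi := i.2
  have hj := j.2
  have := firstLoses_iff_moverResult (t := t) (κ := κ) (i := i + 1) (j := j + 1)
    ⟨by omega, by omega⟩ ⟨by omega, by omega⟩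
  simpa [MoverResultEventually] using this

theorem firstWins_iff_eventually (i j : Fin (κ - 1)) (t : WeightedTree) :
    FirstWins κ t [] (i + 1) (j + 1) ↔ MoverResultEventually κ true t (i + 1) (j + 1) := by
  have hi := i.2
  have hj := j.2
  have := firstWins_iff_moverResult (t := t) (κ := κ) (i := i + 1) (j := j + 1)
    ⟨by omega, by omega⟩ ⟨by omega, by omega⟩
  simpa [MoverResultEventually] using this

theorem lossMatrix_eq_eventMatrix (κ : ℕ) :
    lossMatrix κ χ p = eventMatrix κ χ p (MoverResultEventually κ false) := by
  ext i j
  simp only [lossMatrix, eventMatrix, Matrix.of_apply, firstLoses_iff_eventually]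

theorem winMatrix_eq_eventMatrix (κ : ℕ) :
    winMatrix κ χ p = eventMatrix κ χ p (MoverResultEventually κ true) := by
  ext i j
  simp only [winMatrix, eventMatrix, Matrix.of_apply, firstWins_iff_eventually]

theorem lossMatrix_eq_gMap (hκ : 0 < κ) :
    lossMatrix κ χ p = gMap χ p (onesMatrix (κ - 1) - winMatrix κ χ p) := by
  rw [lossMatrix_eq_eventMatrix, winMatrix_eq_eventMatrix]
  exact eventMatrix_eq_gMap hκ χ p (measurable_moverResultEventually κ true)
    (fun t s i j => exists_congr fun n => moverResult_setRootWeight κ true n t s i j)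
    (moverResultEventually_false_iff κ)

theorem ones_sub_winMatrix_eq_gMap (hκ : 0 < κ) :
    onesMatrix (κ - 1) - winMatrix κ χ p = gMap χ p (lossMatrix κ χ p) := by
  rw [lossMatrix_eq_eventMatrix, winMatrix_eq_eventMatrix]
  have h := eventMatrix_eq_gMap hκ χ p
    (V := fun t i j => ¬ MoverResultEventually κ true t i j)
    (V' := fun t i j => ¬ MoverResultEventually κ false t i j)
    (fun i j => (measurable_moverResultEventually κ false i j).not)
    (fun t s i j => not_congr
      (exists_congr fun n => moverResult_setRootWeight κ false n t s i j))
    (fun t i j => (not_congr (moverResultEventually_true_iff κ t i j)).trans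
      (not_exists_child_iff hκ))
  rw [eventMatrix_not χ p (measurable_moverResultEventually κ true),
    eventMatrix_not χ p (measurable_moverResultEventually κ false), sub_sub_cancel] at h
  exact h

/-! ### Bounded games as iterates of `h`, and the bounds on fixed points -/

/-- Continuity of the measure from below along increasing bounds; only even ones are kept, since one
application of `h` corresponds to two moves. -/
theorem tendsto_resultMatrix (κ : ℕ) (w : Bool) (i j : Fin (κ - 1)) :
    Filter.Tendsto (fun n => resultMatrix κ χ p w (2 * n) i j) Filter.atTop
      (nhds (eventMatrix κ χ p (MoverResultEventually κ w) i j)) := by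
  have hm : Monotone fun n => {t : WeightedTree | MoverResult κ w n t (i + 1) (j + 1)} :=
    fun m n hmn t ht => MoverResult.mono hmn ht
  have h := tendsto_measure_iUnion_atTop (μ := gwMeasure χ p) hm
  have hU : (⋃ n, {t : WeightedTree | MoverResult κ w n t (i + 1) (j + 1)}) =
      {t | MoverResultEventually κ w t (i + 1) (j + 1)} := by
    ext t
    simp [MoverResultEventually]
  rw [hU] at h
  exact ((ENNReal.tendsto_toReal (measure_ne_top _ _)).comp h).comp
    (Filter.tendsto_id.const_mul_atTop' (by norm_num : 0 < 2))

theorem ones_sub_mem {n : ℕ} {X : Matrix (Fin n) (Fin n) ℝ} (hX : X ∈ unitMatrices n) :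
    onesMatrix n - X ∈ unitMatrices n := by
  intro i j
  have := hX i j
  simp only [onesMatrix, Matrix.sub_apply, Matrix.of_apply]
  exact ⟨by linarith [this.2], by linarith [this.1]⟩

theorem hMap_le_hMap (hκ : 0 < κ) {X Y : Matrix (Fin (κ - 1)) (Fin (κ - 1)) ℝ}
    (hX : X ∈ unitMatrices (κ - 1)) (hY : Y ∈ unitMatrices (κ - 1))
    (hXY : ∀ i j, X i j ≤ Y i j) (i j : Fin (κ - 1)) : hMap χ p X i j ≤ hMap χ p Y i j := by
  rw [hMap_eq_gMap_gMap, hMap_eq_gMap_gMap]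
  exact gMap_antitone hκ χ p (gMap_mem hκ χ p hY) (gMap_mem hκ χ p hX)
    (gMap_antitone hκ χ p hX hY hXY) i j

/-- The outer matrices start at `0` and `J` and evolve by the monotone map `h`, which leaves `X` in
place. -/
theorem resultMatrix_sandwich (hκ : 0 < κ) {X : Matrix (Fin (κ - 1)) (Fin (κ - 1)) ℝ}
    (hX : X ∈ unitMatrices (κ - 1)) (hfix : Function.IsFixedPt (hMap χ p) X) (n : ℕ) :
    (∀ i j, resultMatrix κ χ p false (2 * n) i j ≤ X i j) ∧
      ∀ i j, X i j ≤ (onesMatrix (κ - 1) - resultMatrix κ χ p true (2 * n)) i j := by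
  induction n with
  | zero =>
    simp only [mul_zero, resultMatrix_zero, sub_zero]
    exact ⟨fun i j => (hX i j).1, fun i j => (hX i j).2⟩
  | succ n ih =>
    have h₁ : resultMatrix κ χ p false (2 * (n + 1)) =
        hMap χ p (resultMatrix κ χ p false (2 * n)) := by
      -- The intermediate matrix is `J - W_{2n+1}`: one application of `g` turns losses into
      -- non-wins, the next one turns these back into losses.
      rw [hMap_eq_gMap_gMap, ← ones_sub_resultMatrix_true_succ hκ, ← resultMatrix_false_succ hκ]
      rfl
    have h₂ : onesMatrix (κ - 1) - resultMatrix κ χ p true (2 * (n + 1)) =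
        hMap χ p (onesMatrix (κ - 1) - resultMatrix κ χ p true (2 * n)) := by
      rw [hMap_eq_gMap_gMap, ← resultMatrix_false_succ hκ, ← ones_sub_resultMatrix_true_succ hκ]
      rfl
    have hX' : hMap χ p X = X := hfix
    rw [h₁, h₂, ← hX']
    exact ⟨hMap_le_hMap χ p hκ (eventMatrix_mem κ χ p _) hX ih.1,
      hMap_le_hMap χ p hκ hX (ones_sub_mem (eventMatrix_mem κ χ p _)) ih.2⟩

theorem fixedPt_bounds (hκ : 0 < κ) {X : Matrix (Fin (κ - 1)) (Fin (κ - 1)) ℝ}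
    (hX : X ∈ unitMatrices (κ - 1)) (hfix : Function.IsFixedPt (hMap χ p) X) :
    (∀ i j, lossMatrix κ χ p i j ≤ X i j) ∧
      ∀ i j, X i j ≤ (onesMatrix (κ - 1) - winMatrix κ χ p) i j := by
  rw [lossMatrix_eq_eventMatrix, winMatrix_eq_eventMatrix]
  constructor
  · intro i j
    exact le_of_tendsto' (tendsto_resultMatrix χ p κ false i j)
      fun n => (resultMatrix_sandwich χ p hκ hX hfix n).1 i j
  · intro i j
    exact ge_of_tendsto' ((tendsto_resultMatrix χ p κ true i j).const_sub 1)
      fun n => (resultMatrix_sandwich χ p hκ hX hfix n).2 i j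

theorem drawMatrix_eq (κ : ℕ) :
    drawMatrix κ χ p = onesMatrix (κ - 1) - winMatrix κ χ p - lossMatrix κ χ p := by
  ext i j
  have hW : MeasurableSet {t | FirstWins κ t [] (i + 1) (j + 1)} := by
    simp only [firstWins_iff_eventually]
    exact measurableSet_setOfPred.2 (measurable_moverResultEventually κ true (i + 1) (j + 1))
  have hL : MeasurableSet {t | FirstLoses κ t [] (i + 1) (j + 1)} := by
    simp only [firstLoses_iff_eventually]
    exact measurableSet_setOfPred.2 (measurable_moverResultEventually κ false (i + 1) (j + 1))
  have hd : Disjoint {t | FirstWins κ t [] (i + 1) (j + 1)}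
      {t | FirstLoses κ t [] (i + 1) (j + 1)} :=
    Set.disjoint_left.2 fun t h₁ h₂ => not_firstWins_and_firstLoses κ t [] _ _ ⟨h₁, h₂⟩
  have hD : {t | IsDraw κ t [] (i + 1) (j + 1)} =
      ({t | FirstWins κ t [] (i + 1) (j + 1)} ∪ {t | FirstLoses κ t [] (i + 1) (j + 1)})ᶜ := by
    ext t
    simp [IsDraw]
  simp only [drawMatrix, lossMatrix, winMatrix, onesMatrix, Matrix.of_apply, Matrix.sub_apply]
  rw [hD, probReal_compl_eq_one_sub (hW.union hL), measureReal_union hd hL]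
  ring

end TreeGame

end

open TreeGame
theorem theorem1 (κ : ℕ) (hκ : 0 < κ) (χ : PMF ℕ) (hχ : χ 0 < 1) (p : PMF SignType) :
    -- `h` and `g` map `S` to itself, and `h = g ∘ g` there
    (Set.MapsTo (hMap χ p) (unitMatrices (κ - 1)) (unitMatrices (κ - 1)) ∧
      Set.MapsTo (gMap χ p) (unitMatrices (κ - 1)) (unitMatrices (κ - 1)) ∧
      ∀ X ∈ unitMatrices (κ - 1), hMap χ p X = gMap χ p (gMap χ p X)) ∧
    -- `L` and `J - W` are fixed points of `h` in `S`
    (lossMatrix κ χ p ∈ unitMatrices (κ - 1) ∧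
      Function.IsFixedPt (hMap χ p) (lossMatrix κ χ p)) ∧
    (onesMatrix (κ - 1) - winMatrix κ χ p ∈ unitMatrices (κ - 1) ∧
      Function.IsFixedPt (hMap χ p) (onesMatrix (κ - 1) - winMatrix κ χ p)) ∧
    -- every fixed point of `h` in `S` lies between them
    (∀ X ∈ unitMatrices (κ - 1), Function.IsFixedPt (hMap χ p) X →
      (∀ i j, lossMatrix κ χ p i j ≤ X i j) ∧
      (∀ i j, X i j ≤ (onesMatrix (κ - 1) - winMatrix κ χ p) i j)) ∧
    -- all draw probabilities vanish if and only if `h` has a unique fixed point in `S`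
    ((∀ i j, drawMatrix κ χ p i j = 0) ↔
      ∃! X, X ∈ unitMatrices (κ - 1) ∧ Function.IsFixedPt (hMap χ p) X) ∧
    -- in that case `g` has a unique fixed point in `S`, and it equals both `L` and `J - W`
    ((∃! X, X ∈ unitMatrices (κ - 1) ∧ Function.IsFixedPt (hMap χ p) X) →
      (∃! X, X ∈ unitMatrices (κ - 1) ∧ Function.IsFixedPt (gMap χ p) X) ∧
      ∀ X ∈ unitMatrices (κ - 1), Function.IsFixedPt (gMap χ p) X →
        X = lossMatrix κ χ p ∧ X = onesMatrix (κ - 1) - winMatrix κ χ p) := by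
  have hL : lossMatrix κ χ p ∈ unitMatrices (κ - 1) :=
    fun _ _ => ⟨measureReal_nonneg, measureReal_le_one⟩
  have hW : onesMatrix (κ - 1) - winMatrix κ χ p ∈ unitMatrices (κ - 1) :=
    ones_sub_mem fun _ _ => ⟨measureReal_nonneg, measureReal_le_one⟩
  have hLg := lossMatrix_eq_gMap χ p hκ
  have hWg := ones_sub_winMatrix_eq_gMap χ p hκ
  have hLfix : Function.IsFixedPt (hMap χ p) (lossMatrix κ χ p) := by
    rw [Function.IsFixedPt, hMap_eq_gMap_gMap, ← hWg, ← hLg]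
  have hWfix : Function.IsFixedPt (hMap χ p) (onesMatrix (κ - 1) - winMatrix κ χ p) := by
    rw [Function.IsFixedPt, hMap_eq_gMap_gMap, ← hLg, ← hWg]
  have hgh : ∀ X : Matrix (Fin (κ - 1)) (Fin (κ - 1)) ℝ,
      Function.IsFixedPt (gMap χ p) X → Function.IsFixedPt (hMap χ p) X := by
    intro X (hX : gMap χ p X = X)
    rw [Function.IsFixedPt, hMap_eq_gMap_gMap, hX, hX]
  refine ⟨⟨fun X hX => ?_, fun X hX => gMap_mem hκ χ p hX, fun X _ => hMap_eq_gMap_gMap χ p X⟩,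
    ⟨hL, hLfix⟩, ⟨hW, hWfix⟩, fun X hX hfix => fixedPt_bounds χ p hκ hX hfix, ⟨fun h => ?_, ?_⟩, ?_⟩
  · rw [hMap_eq_gMap_gMap]
    exact gMap_mem hκ χ p (gMap_mem hκ χ p hX)
  · have hd : drawMatrix κ χ p = 0 := by
      ext i j
      exact h i j
    -- No draws means `J - W = L`, so the lower and upper bounds for fixed points coincide.
    rw [drawMatrix_eq, sub_eq_zero] at hd
    refine ⟨_, ⟨hL, hLfix⟩, fun Y hY => ?_⟩
    obtain ⟨h₁, h₂⟩ := fixedPt_bounds χ p hκ hY.1 hY.2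
    rw [hd] at h₂
    ext i j
    exact le_antisymm (h₂ i j) (h₁ i j)
  · intro h i j
    have := h.unique ⟨hW, hWfix⟩ ⟨hL, hLfix⟩
    rw [drawMatrix_eq, this, sub_self]
    rfl
  · intro h
    have heq := h.unique ⟨hL, hLfix⟩ ⟨hW, hWfix⟩
    have huniq : ∀ X ∈ unitMatrices (κ - 1), Function.IsFixedPt (gMap χ p) X →
        X = lossMatrix κ χ p :=
      fun X hX hfix => h.unique ⟨hX, hgh X hfix⟩ ⟨hL, hLfix⟩
    refine ⟨⟨_, ⟨hL, ?_⟩, fun Y hY => huniq Y hY.1 hY.2⟩,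
      fun X hX hfix => ⟨huniq X hX hfix, (huniq X hX hfix).trans heq⟩⟩
    -- `g(L)` is always `J - W`; uniqueness for `h` identifies it with `L`.
    rw [Function.IsFixedPt, ← hWg, ← heq]
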